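/- Let $1<p<\infty$ and $0<\alpha<\infty$, and let $\mathbb D$ be the open unit disc of $\mathbb C$. For $\mu>0$ let $A^p_\mu$ be the weighted Bergman space of all analytic functions $f:\mathbb D\to\mathbb C$ with $$\|f\|_{p,\mu}=\Big(\int_{\mathbb D}|f(z)|^p(1-|z|)^\mu\,dA(z)\Big)^{1/p}<\infty ,\qquad dA=\tfrac1\pi\,dx\,dy .$$ Let $A^p_{\alpha+}=\bigcap_{\mu>\alpha}A^p_\mu$, with the (Fréchet) locally convex topology generated by the norms $\|\cdot\|_{p,\alpha+1/n}$, $n=1,2,\dots$, and let $A^p_{\alpha-}=\bigcup_{0<\mu<\alpha}A^p_\mu$, with the (LB)-space topology, i.e. the finest locally convex topology for which all inclusions $A^p_\mu\hookrightarrow A^p_{\alpha-}$, $0<\mu<\alpha$, are continuous. A sequence $(x_j)_{j\ge0}$ in a locally convex space $E$ over $\mathbb C$ is a Schauder basis of $E$ if there are continuous linear forms $f_j:E\to\mathbb C$ such that for every $y\in E$ one has $y=\sum_{j=0}^\infty f_j(y)x_j$, as the limit of the partial sums in $E$, and this is the only expansion $y=\sum_{j=0}^\infty c_jx_j$ of $y$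 with coefficients $c_j\in\mathbb C$. Then: 1. the monomials $(z^j)_{j\ge0}$ form a Schauder basis of $A^p_{\alpha+}$, and for every $f\in A^p_{\alpha+}$ the Taylor series $\sum_{j=0}^\infty \frac{f^{(j)}(0)}{j!}z^j$ converges to $f$ in $A^p_{\alpha+}$; 2. the monomials $(z^j)_{j\ge0}$ form a Schauder basis of $A^p_{\alpha-}$, and for every $f\in A^p_{\alpha-}$ the Taylor series $\sum_{j=0}^\infty \frac{f^{(j)}(0)}{j!}z^j$ converges to $f$ in $A^p_{\alpha-}$. -/

import Mathlib

open MeasureTheory Filter Topology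
open scoped ENNReal

noncomputable section

namespace WeightedBergman

/-- The open unit disc of the complex plane. -/
abbrev Disc : Type := Metric.ball (0 : ℂ) 1

/-- Extension by zero of a function on the unit disc to the whole plane. -/
def extendZero (f : Disc → ℂ) : ℂ → ℂ := Function.extend Subtype.val f 0

lemma extendZero_coe (f : Disc → ℂ) (z : Disc) : extendZero f z = f z :=
  Subtype.val_injective.extend_apply f 0 z

/-- `f` is analytic on the unit disc. -/
def IsAnalytic (f : Disc → ℂ) : Prop :=
  DifferentiableOn ℂ (extendZero f) (Metric.ball 0 1)

lemma isAnalytic_of_eq {f : Disc → ℂ} {F : ℂ → ℂ}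
    (hF : DifferentiableOn ℂ F (Metric.ball 0 1)) (h : ∀ z : Disc, f z = F z) :
    IsAnalytic f :=
  hF.congr fun z hz => (extendZero_coe f ⟨z, hz⟩).trans (h ⟨z, hz⟩)

lemma IsAnalytic.continuous {f : Disc → ℂ} (hf : IsAnalytic f) : Continuous f := by
  have h := continuousOn_iff_continuous_domRestrict.1 hf.continuousOn
  have e : (Metric.ball (0 : ℂ) 1).domRestrict (extendZero f) = f :=
    funext fun z => extendZero_coe f z
  rwa [e] at h

/-- The measure `(1 - |z|)^α dA(z)` on the unit disc, where `dA = π⁻¹ dx dy`. -/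
def weightMeasure (α : ℝ) : Measure Disc :=
  (volume.comap Subtype.val).withDensity fun z => ENNReal.ofReal (Real.pi⁻¹ * (1 - ‖(z : ℂ)‖) ^ α)

lemma one_sub_norm_pos (z : Disc) : 0 < 1 - ‖(z : ℂ)‖ := by
  have := mem_ball_zero_iff.1 z.2
  linarith

lemma measurable_weight (α : ℝ) :
    Measurable fun z : Disc => ENNReal.ofReal (Real.pi⁻¹ * (1 - ‖(z : ℂ)‖) ^ α) := by
  fun_prop

lemma weightMeasure_mono {μ γ : ℝ} (h : μ ≤ γ) : weightMeasure γ ≤ weightMeasure μ := by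
  refine withDensity_mono (Eventually.of_forall fun z => ENNReal.ofReal_le_ofReal ?_)
  refine mul_le_mul_of_nonneg_left ?_ (inv_nonneg.2 Real.pi_pos.le)
  exact Real.rpow_le_rpow_of_exponent_ge (one_sub_norm_pos z)
    (by linarith [norm_nonneg (z : ℂ)]) h

lemma isFiniteMeasure_weightMeasure {μ : ℝ} (h : 0 ≤ μ) :
    IsFiniteMeasure (weightMeasure μ) := by
  have hv : IsFiniteMeasure ((volume : Measure ℂ).comap (Subtype.val : Disc → ℂ)) := by
    constructor
    rw [comap_subtype_coe_apply measurableSet_ball, Set.image_univ, Subtype.range_coe]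
    exact measure_ball_lt_top
  refine isFiniteMeasure_withDensity_ofReal (Integrable.hasFiniteIntegral ?_)
  refine Integrable.of_bound (by fun_prop) (Real.pi⁻¹ * 1) (Eventually.of_forall fun z => ?_)
  rw [Real.norm_of_nonneg
    (mul_nonneg (inv_nonneg.2 Real.pi_pos.le) (Real.rpow_nonneg (one_sub_norm_pos z).le _))]
  exact mul_le_mul_of_nonneg_left (Real.rpow_le_one (one_sub_norm_pos z).le
    (by linarith [norm_nonneg (z : ℂ)]) h) (inv_nonneg.2 Real.pi_pos.le)

/-- The weighted Bergman space `A^p_α`, as a space of functions: the analytic functions `f` on the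
unit disc with `∫ |f|^p (1 - |z|)^α dA < ∞`. -/
def bergman (p : ℝ≥0∞) (α : ℝ) : Submodule ℂ (Disc → ℂ) where
  carrier := {f | IsAnalytic f ∧ MemLp f p (weightMeasure α)}
  zero_mem' := ⟨isAnalytic_of_eq (F := 0) (differentiableOn_const 0) fun _ => rfl, MemLp.zero⟩
  add_mem' {f g} hf hg := ⟨isAnalytic_of_eq (hf.1.add hg.1) fun z => by
    simp [extendZero_coe], hf.2.add hg.2⟩
  smul_mem' c f hf := ⟨isAnalytic_of_eq (hf.1.const_smul c) fun z => by
    simp [extendZero_coe], hf.2.const_smul c⟩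

lemma bergman_mono (p : ℝ≥0∞) {μ γ : ℝ} (h : μ ≤ γ) : bergman p μ ≤ bergman p γ :=
  fun _ hf => ⟨hf.1, hf.2.mono_measure (weightMeasure_mono h)⟩

/-- `A^p_{α+}`, as a space of functions: the intersection of all `A^p_μ` with `μ > α`. -/
def bergmanPlus (p : ℝ≥0∞) (α : ℝ) : Submodule ℂ (Disc → ℂ) :=
  ⨅ μ : Set.Ioi α, bergman p μ

/-- `A^p_{α-}`, as a space of functions: the union of all `A^p_μ` with `0 < μ < α`. Since the
union is directed it is written as a supremum of subspaces, see `mem_bergmanMinus_iff`. -/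
def bergmanMinus (p : ℝ≥0∞) (α : ℝ) : Submodule ℂ (Disc → ℂ) :=
  ⨆ μ : Set.Ioo 0 α, bergman p μ

lemma mem_bergmanPlus_iff {p : ℝ≥0∞} {α : ℝ} {f : Disc → ℂ} :
    f ∈ bergmanPlus p α ↔ ∀ μ, α < μ → f ∈ bergman p μ := by
  simp [bergmanPlus, Submodule.mem_iInf]

lemma mem_bergmanMinus_iff {p : ℝ≥0∞} {α : ℝ} (hα : 0 < α) {f : Disc → ℂ} :
    f ∈ bergmanMinus p α ↔ ∃ μ, 0 < μ ∧ μ < α ∧ f ∈ bergman p μ := by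
  have : Nonempty (Set.Ioo 0 α) := ⟨⟨α / 2, by constructor <;> linarith⟩⟩
  have hm : Monotone fun μ : Set.Ioo 0 α => bergman p (μ : ℝ) := fun _ _ h => bergman_mono p h
  rw [bergmanMinus, Submodule.mem_iSup_of_directed _ hm.directed_le]
  simp [and_assoc]

lemma bergman_le_bergmanMinus (p : ℝ≥0∞) {α μ : ℝ} (hμ : μ ∈ Set.Ioo 0 α) :
    bergman p μ ≤ bergmanMinus p α :=
  le_iSup (fun ν : Set.Ioo 0 α => bergman p (ν : ℝ)) ⟨μ, hμ⟩

/-! The spaces themselves are type synonyms, so that they do not inherit the topology of pointwise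
convergence from the space of all functions on the disc. -/

/-- The weighted Bergman space `A^p_α`. -/
def Bergman (p : ℝ≥0∞) (α : ℝ) : Type := bergman p α

/-- The space `A^p_{α+}`. -/
def BergmanPlus (p : ℝ≥0∞) (α : ℝ) : Type := bergmanPlus p α

/-- The space `A^p_{α-}`. -/
def BergmanMinus (p : ℝ≥0∞) (α : ℝ) : Type := bergmanMinus p α

section Algebra

variable (p : ℝ≥0∞) (α : ℝ)

instance : AddCommGroup (Bergman p α) := inferInstanceAs (AddCommGroup (bergman p α))

instance : Module ℂ (Bergman p α) := inferInstanceAs (Module ℂ (bergman p α))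

instance : AddCommGroup (BergmanPlus p α) := inferInstanceAs (AddCommGroup (bergmanPlus p α))

instance : Module ℂ (BergmanPlus p α) := inferInstanceAs (Module ℂ (bergmanPlus p α))

instance : AddCommGroup (BergmanMinus p α) := inferInstanceAs (AddCommGroup (bergmanMinus p α))

instance : Module ℂ (BergmanMinus p α) := inferInstanceAs (Module ℂ (bergmanMinus p α))

end Algebra

/-- The norm `(∫ |f|^p (1 - |z|)^α dA)^(1/p)` of `A^p_α`. -/
def bergmanSeminorm (p : ℝ≥0∞) [Fact (1 ≤ p)] (α : ℝ) : Seminorm ℂ (bergman p α) :=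
  Seminorm.of (fun f => (eLpNorm (f : Disc → ℂ) p (weightMeasure α)).toReal)
    (fun f g => by
      rw [← ENNReal.toReal_add f.2.2.2.ne g.2.2.2.ne]
      exact ENNReal.toReal_mono (ENNReal.add_ne_top.2 ⟨f.2.2.2.ne, g.2.2.2.ne⟩)
        (eLpNorm_add_le f.2.2.1 g.2.2.1 Fact.out))
    (fun c f => by
      rw [Submodule.coe_smul, eLpNorm_const_smul, ENNReal.toReal_mul]
      simp)

lemma eq_zero_of_bergmanSeminorm_eq_zero {p : ℝ≥0∞} [Fact (1 ≤ p)] {α : ℝ} (f : bergman p α)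
    (h : bergmanSeminorm p α f = 0) : f = 0 := by
  have h0 : eLpNorm (f : Disc → ℂ) p (weightMeasure α) = 0 :=
    ((ENNReal.toReal_eq_zero_iff _).1 h).resolve_right f.2.2.2.ne
  rw [eLpNorm_eq_zero_iff f.2.2.1 (zero_lt_one.trans_le (Fact.out : 1 ≤ p)).ne'] at h0
  have h1 : (f : Disc → ℂ) =ᵐ[volume.comap Subtype.val] 0 := by
    have := (ae_withDensity_iff (measurable_weight α)).1 h0
    filter_upwards [this] with z hz
    refine hz (ENNReal.ofReal_pos.2 ?_).ne'
    exact mul_pos (inv_pos.2 Real.pi_pos) (Real.rpow_pos_of_pos (one_sub_norm_pos z) _)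
  have h2 : ∀ᵐ z ∂(volume.restrict (Metric.ball (0 : ℂ) 1)), extendZero f z = (0 : ℂ → ℂ) z := by
    rw [ae_restrict_iff_subtype measurableSet_ball]
    filter_upwards [h1] with z hz
    rw [extendZero_coe, hz]; rfl
  have h3 := Measure.eqOn_open_of_ae_eq h2 Metric.isOpen_ball f.2.1.continuousOn continuousOn_const
  refine Subtype.ext (funext fun z => ?_)
  rw [← extendZero_coe (f : Disc → ℂ) z]
  exact h3 z.2

/-- `A^p_α` carries the norm `(∫ |f|^p (1 - |z|)^α dA)^(1/p)`. -/
instance (p : ℝ≥0∞) [Fact (1 ≤ p)] (α : ℝ) : NormedAddCommGroup (Bergman p α) :=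
  AddGroupNorm.toNormedAddCommGroup
    { (bergmanSeminorm p α).toAddGroupSeminorm with
      eq_zero_of_map_eq_zero' := eq_zero_of_bergmanSeminorm_eq_zero }

instance (p : ℝ≥0∞) [Fact (1 ≤ p)] (α : ℝ) : NormedSpace ℂ (Bergman p α) where
  norm_smul_le c f := (map_smul_eq_mul (bergmanSeminorm p α) c f).le

/-- The inclusion of `A^p_{α+}` into `A^p_μ` for `μ > α`. -/
def fromPlus (p : ℝ≥0∞) {α μ : ℝ} (h : α < μ) : BergmanPlus p α →ₗ[ℂ] Bergman p μ :=
  Submodule.inclusion fun _ hf => mem_bergmanPlus_iff.1 hf μ h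

/-- The inclusion of `A^p_μ` into `A^p_{α-}` for `0 < μ < α`. -/
def toMinus (p : ℝ≥0∞) {α μ : ℝ} (h : μ ∈ Set.Ioo 0 α) : Bergman p μ →ₗ[ℂ] BergmanMinus p α :=
  Submodule.inclusion (bergman_le_bergmanMinus p h)

section Topology

variable (p : ℝ≥0∞) [Fact (1 ≤ p)] (α : ℝ)

/-- The norms `(∫ |f|^p (1 - |z|)^(α + 1/n) dA)^(1/p)`, `n = 1, 2, …`, on `A^p_{α+}`. -/
def plusNorms : SeminormFamily ℂ (BergmanPlus p α) ℕ := fun n =>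
  (normSeminorm ℂ (Bergman p (α + 1 / ((n : ℝ) + 1)))).comp
    (fromPlus p (lt_add_of_pos_right α Nat.one_div_pos_of_nat))

/-- The Fréchet topology of `A^p_{α+}`: the locally convex topology generated by the norms
`plusNorms`. -/
instance : TopologicalSpace (BergmanPlus p α) := (plusNorms p α).moduleFilterBasis.topology

lemma withSeminorms_plusNorms : WithSeminorms (plusNorms p α) := ⟨rfl⟩

instance : IsTopologicalAddGroup (BergmanPlus p α) :=
  (withSeminorms_plusNorms p α).topologicalAddGroup

instance : ContinuousSMul ℂ (BergmanPlus p α) := (withSeminorms_plusNorms p α).continuousSMul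

instance : LocallyConvexSpace ℝ (BergmanPlus p α) :=
  (withSeminorms_plusNorms p α).toLocallyConvexSpace

/-- The (LB)-topology of `A^p_{α-}`: the finest locally convex topology for which all the inclusions
of the normed spaces `A^p_μ`, `0 < μ < α`, are continuous (as in Mathlib, finer topologies are
smaller). -/
instance : TopologicalSpace (BergmanMinus p α) :=
  sInf {t : TopologicalSpace (BergmanMinus p α) |
    @IsTopologicalAddGroup (BergmanMinus p α) t _ ∧
    @ContinuousSMul ℂ (BergmanMinus p α) _ _ t ∧
    @LocallyConvexSpace ℝ (BergmanMinus p α) _ _ _ _ t ∧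
    ∀ (μ : ℝ) (hμ : μ ∈ Set.Ioo 0 α), Continuous[_, t] (toMinus p hμ)}

instance : IsTopologicalAddGroup (BergmanMinus p α) :=
  topologicalAddGroup_sInf fun _ ht => ht.1

instance : ContinuousSMul ℂ (BergmanMinus p α) :=
  continuousSMul_sInf fun _ ht => ht.2.1

instance : LocallyConvexSpace ℝ (BergmanMinus p α) :=
  .sInf fun _ ht => ht.2.2.1

lemma continuous_toMinus {μ : ℝ} (hμ : μ ∈ Set.Ioo 0 α) : Continuous (toMinus p hμ) :=
  continuous_sInf_rng.2 fun _ ht => ht.2.2.2 μ hμ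

end Topology

lemma pow_mem_bergman (p : ℝ≥0∞) {μ : ℝ} (hμ : 0 ≤ μ) (j : ℕ) :
    (fun z : Disc => (z : ℂ) ^ j) ∈ bergman p μ := by
  have := isFiniteMeasure_weightMeasure hμ
  refine ⟨isAnalytic_of_eq (F := fun z => z ^ j) (by fun_prop) fun _ => rfl,
    MemLp.of_bound (by fun_prop) 1 (Eventually.of_forall fun z => ?_)⟩
  rw [norm_pow]
  exact pow_le_one₀ (norm_nonneg _) (by linarith [one_sub_norm_pos z])

/-- The monomial `z ^ j` as an element of `A^p_{α+}`. -/
def monomialPlus (p : ℝ≥0∞) {α : ℝ} (hα : 0 < α) (j : ℕ) : BergmanPlus p α :=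
  ⟨fun z => (z : ℂ) ^ j, mem_bergmanPlus_iff.2 fun _ h => pow_mem_bergman p (hα.trans h).le j⟩

/-- The monomial `z ^ j` as an element of `A^p_{α-}`. -/
def monomialMinus (p : ℝ≥0∞) {α : ℝ} (hα : 0 < α) (j : ℕ) : BergmanMinus p α :=
  ⟨fun z => (z : ℂ) ^ j, (mem_bergmanMinus_iff hα).2
    ⟨α / 2, half_pos hα, half_lt_self hα, pow_mem_bergman p (half_pos hα).le j⟩⟩

/-- The Taylor coefficient `f^(j)(0) / j!` of a function on the disc. -/
def taylorCoeff (f : Disc → ℂ) (j : ℕ) : ℂ :=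
  iteratedDeriv j (extendZero f) 0 / (Nat.factorial j : ℂ)

/-- A sequence `x` in a topological vector space `E` is a Schauder basis if there are continuous
linear forms `f j` such that every `y` has the expansion `y = ∑ f j y • x j` (limit of the partial
sums), and no other expansion `y = ∑ c j • x j` with scalar coefficients. -/
def IsSchauderBasis (𝕜 : Type*) {E : Type*} [NormedField 𝕜] [AddCommGroup E] [Module 𝕜 E]
    [TopologicalSpace E] (x : ℕ → E) : Prop :=
  ∃ f : ℕ → (E →L[𝕜] 𝕜), ∀ y : E,
    Tendsto (fun n => ∑ j ∈ Finset.range n, f j y • x j) atTop (𝓝 y) ∧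
    ∀ c : ℕ → 𝕜, Tendsto (fun n => ∑ j ∈ Finset.range n, c j • x j) atTop (𝓝 y) →
      ∀ j, c j = f j y

end WeightedBergman

end

/-! The proof rests on one estimate (`tendsto_eLpNorm_sub_partialSum`): the Taylor series of a
function in `A^p_μ` converges to it in `A^p_γ` for every `γ > μ`. Both spaces leave room for such a
loss of weight.

Since the weight is radial, rotations act isometrically. The `n`-th Taylor sum is, up to `2π`, the
convolution over rotations with the Dirichlet kernel, so its norm on `A^p_μ` is at most the `L¹`
norm of the kernel, which is `O(n^ε)` for every small `ε > 0`
(`exists_lintegral_dirichletKernel_le`). On the collar `1 - |z| ≤ n^(-1/2)`, passing from `μ` to `γ`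
gains `n^(-(γ-μ)/(2p))`, which beats `n^ε`. Off the collar, the polynomial growth of the
coefficients (`norm_taylorCoeff_le`) bounds the remainder uniformly by a tail of a convergent series
with terms `poly(j) exp(-√j)`.

For `A^p_{α+}`, each defining norm has room for a smaller weight above `α`. For `A^p_{α-}`, a
function in `A^p_μ` is expanded in some `A^p_γ` with `μ < γ < α`. Uniqueness follows because Taylor
coefficients are continuous linear forms biorthogonal to the monomials. -/

namespace WeightedBergman

/-! ### Rotations of the disc and convolution -/

/-- Rotation of the unit disc by the angle `θ`. -/
noncomputable def rotate (θ : ℝ) (z : Disc) : Disc :=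
  ⟨Complex.exp (θ * Complex.I) * z, by
    rw [mem_ball_zero_iff, norm_mul, Complex.norm_exp_ofReal_mul_I, one_mul]
    exact mem_ball_zero_iff.1 z.2⟩

lemma norm_rotate (θ : ℝ) (z : Disc) : ‖(rotate θ z : ℂ)‖ = ‖(z : ℂ)‖ := by
  simp [rotate, Complex.norm_exp_ofReal_mul_I]

lemma continuous_rotate : Continuous fun x : ℝ × Disc => rotate x.1 x.2 := by
  unfold rotate
  fun_prop

lemma continuous_rotate_angle (z : Disc) : Continuous fun θ => rotate θ z :=
  continuous_rotate.comp (by fun_prop : Continuous fun θ : ℝ => (θ, z))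

lemma continuous_rotate_right (θ : ℝ) : Continuous (rotate θ) :=
  continuous_rotate.comp (by fun_prop : Continuous fun z : Disc => (θ, z))

lemma rotate_neg_rotate (θ : ℝ) (z : Disc) : rotate (-θ) (rotate θ z) = z := by
  ext
  simp [rotate, ← mul_assoc, ← Complex.exp_add]

lemma measurePreserving_rotate_comap (θ : ℝ) :
    MeasurePreserving (rotate θ) ((volume : Measure ℂ).comap (Subtype.val : Disc → ℂ))
      (volume.comap Subtype.val) := by
  refine ⟨(continuous_rotate_right θ).measurable, Measure.ext fun s hs => ?_⟩
  have hpre : MeasurableSet (rotate θ ⁻¹' s) := (continuous_rotate_right θ).measurable hs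
  have he : MeasurableEmbedding (Subtype.val : Disc → ℂ) :=
    MeasurableEmbedding.subtype_coe measurableSet_ball
  rw [Measure.map_apply (continuous_rotate_right θ).measurable hs, he.comap_apply,
    he.comap_apply]
  have hm := (rotation (Circle.exp θ)).measurePreserving
  rw [← hm.measure_preimage (he.measurableSet_image.2 hs).nullMeasurableSet]
  congr 1
  ext w
  simp only [Set.mem_image, Set.mem_preimage, rotation_apply, Circle.coe_exp]
  constructor
  · rintro ⟨z, hz, rfl⟩
    exact ⟨_, hz, rfl⟩
  · rintro ⟨z, hz, h⟩
    refine ⟨rotate (-θ) z, ?_, ?_⟩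
    · have := rotate_neg_rotate (-θ) z
      rw [neg_neg] at this
      rwa [this]
    · simp [rotate, h, ← mul_assoc, ← Complex.exp_add]

/-- The weight is radial and rotations preserve area. -/
lemma lintegral_rotate (μ : ℝ) (θ : ℝ) {F : Disc → ℝ≥0∞} (hF : Measurable F) :
    ∫⁻ z, F (rotate θ z) ∂weightMeasure μ = ∫⁻ z, F z ∂weightMeasure μ := by
  have hr := (continuous_rotate_right θ).measurable
  rw [weightMeasure, lintegral_withDensity_eq_lintegral_mul _ (measurable_weight μ) hF,
    lintegral_withDensity_eq_lintegral_mul _ (measurable_weight μ)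
      (show Measurable fun z => F (rotate θ z) from hF.comp hr),
    ← (measurePreserving_rotate_comap θ).lintegral_comp ((measurable_weight μ).mul hF)]
  simp [norm_rotate]

/-- Jensen's inequality for the weight `k`. -/
lemma rpow_lintegral_mul_le {X : Type*} [MeasurableSpace X] (m : Measure X) {k g : X → ℝ≥0∞}
    (hk : Measurable k) (hg : Measurable g) {q : ℝ} (hq : 1 ≤ q) :
    (∫⁻ x, k x * g x ∂m) ^ q ≤ (∫⁻ x, k x ∂m) ^ (q - 1) * ∫⁻ x, k x * g x ^ q ∂m := by
  have hq0 : 0 < q := by linarith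
  -- Comparison of the `L¹` and `L^q` norms for the measure `k dm`, raised to the power `q` below.
  have h := eLpNorm'_le_eLpNorm'_mul_rpow_measure_univ (μ := m.withDensity k) (f := g)
    one_pos hq hg.aestronglyMeasurable
  simp only [eLpNorm'_eq_lintegral_enorm, enorm_eq_self, ENNReal.rpow_one, div_one] at h
  rw [lintegral_withDensity_eq_lintegral_mul _ hk hg,
    lintegral_withDensity_eq_lintegral_mul _ hk (hg.pow_const q), withDensity_apply _ .univ,
    Measure.restrict_univ] at h
  have h2 := ENNReal.rpow_le_rpow h hq0.le
  rw [ENNReal.mul_rpow_of_nonneg _ _ hq0.le, ← ENNReal.rpow_mul, ← ENNReal.rpow_mul,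
    one_div_mul_cancel hq0.ne', ENNReal.rpow_one, mul_comm (∫⁻ _, _ ∂m)] at h2
  have e : (1 - 1 / q) * q = q - 1 := by field_simp
  rw [e] at h2
  exact h2

/-- Young's inequality for convolution over rotations of the disc. -/
lemma eLpNorm_convolution_le {p : ℝ≥0∞} (hp : 1 ≤ p) (hp' : p ≠ ∞) {μ : ℝ} (hμ : 0 ≤ μ)
    {k : ℝ → ℂ} (hk : Continuous k) {f : Disc → ℂ} (hf : Continuous f) :
    eLpNorm (fun z => ∫ θ in Set.Ioc (-Real.pi) Real.pi, k θ * f (rotate θ z)) p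
        (weightMeasure μ) ≤
      (∫⁻ θ in Set.Ioc (-Real.pi) Real.pi, ‖k θ‖ₑ) * eLpNorm f p (weightMeasure μ) := by
  have := isFiniteMeasure_weightMeasure hμ
  have hp0 : p ≠ 0 := (zero_lt_one.trans_le hp).ne'
  set q := p.toReal with hqd
  have hq : 1 ≤ q := by
    have := ENNReal.toReal_mono hp' hp
    simpa using this
  have hq0 : 0 < q := by linarith
  have hfr : Measurable fun x : ℝ × Disc => ‖f (rotate x.1 x.2)‖ₑ :=
    (hf.comp continuous_rotate).measurable.enorm
  have hke : Measurable fun θ => ‖k θ‖ₑ := hk.measurable.enorm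
  set m := (volume : Measure ℝ).restrict (Set.Ioc (-Real.pi) Real.pi) with hm
  set K := ∫⁻ θ, ‖k θ‖ₑ ∂m with hK
  rw [eLpNorm_eq_lintegral_rpow_enorm_toReal hp0 hp',
    eLpNorm_eq_lintegral_rpow_enorm_toReal hp0 hp', ← hqd]
  have key : ∫⁻ z, ‖∫ θ, k θ * f (rotate θ z) ∂m‖ₑ ^ q ∂weightMeasure μ ≤
      K ^ q * ∫⁻ z, ‖f z‖ₑ ^ q ∂weightMeasure μ := by
    -- Jensen for each fixed `z`, then Tonelli, then rotation invariance of the inner integral; the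
    -- remaining integral of the kernel turns `K ^ (q - 1)` into `K ^ q`.
    calc ∫⁻ z, ‖∫ θ, k θ * f (rotate θ z) ∂m‖ₑ ^ q ∂weightMeasure μ
        ≤ ∫⁻ z, K ^ (q - 1) * ∫⁻ θ, ‖k θ‖ₑ * ‖f (rotate θ z)‖ₑ ^ q ∂m ∂weightMeasure μ := by
          refine lintegral_mono fun z => ?_
          refine le_trans ?_ (rpow_lintegral_mul_le m hke
            (hf.comp (continuous_rotate_angle z)).measurable.enorm hq)
          refine ENNReal.rpow_le_rpow ?_ hq0.le
          refine (enorm_integral_le_lintegral_enorm _).trans_eq ?_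
          simp [enorm_mul]
      _ = K ^ (q - 1) * ∫⁻ z, ∫⁻ θ, ‖k θ‖ₑ * ‖f (rotate θ z)‖ₑ ^ q ∂m ∂weightMeasure μ := by
          refine lintegral_const_mul _ ?_
          refine Measurable.lintegral_prod_right' (ν := m)
            (f := fun x : Disc × ℝ => ‖k x.2‖ₑ * ‖f (rotate x.2 x.1)‖ₑ ^ q) ?_
          exact (hke.comp measurable_snd).mul ((hfr.comp measurable_swap).pow_const q)
      _ = K ^ (q - 1) * ∫⁻ θ, ∫⁻ z, ‖k θ‖ₑ * ‖f (rotate θ z)‖ₑ ^ q ∂weightMeasure μ ∂m := by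
          rw [lintegral_lintegral_swap]
          exact ((hke.comp measurable_snd).mul
            ((hfr.comp measurable_swap).pow_const q)).aemeasurable
      _ = K ^ (q - 1) * ∫⁻ θ, ‖k θ‖ₑ * ∫⁻ z, ‖f z‖ₑ ^ q ∂weightMeasure μ ∂m := by
          congr 1
          refine lintegral_congr fun θ => ?_
          have hm' : Measurable fun z => ‖f (rotate θ z)‖ₑ ^ q :=
            (hf.comp (continuous_rotate_right θ)).measurable.enorm.pow_const q
          rw [lintegral_const_mul _ hm',
            lintegral_rotate μ θ (F := fun z => ‖f z‖ₑ ^ q) (hf.measurable.enorm.pow_const q)]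
      _ = K ^ q * ∫⁻ z, ‖f z‖ₑ ^ q ∂weightMeasure μ := by
          rw [lintegral_mul_const _ hke, ← mul_assoc, ← hK]
          congr 1
          nth_rewrite 2 [← ENNReal.rpow_one K]
          rw [← ENNReal.rpow_add_of_nonneg _ _ (by linarith) zero_le_one, sub_add_cancel]
  refine (ENNReal.rpow_le_rpow key (by positivity)).trans_eq ?_
  rw [ENNReal.mul_rpow_of_nonneg _ _ (by positivity), ← ENNReal.rpow_mul,
    mul_one_div_cancel hq0.ne', ENNReal.rpow_one]

/-! ### Taylor coefficients as averages over rotations -/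

/-- The Taylor expansion on the disc. -/
lemma hasSum_taylorCoeff {f : Disc → ℂ} (hf : IsAnalytic f) (z : Disc) :
    HasSum (fun j => taylorCoeff f j * (z : ℂ) ^ j) (f z) := by
  have h := Complex.hasSum_taylorSeries_on_ball (r := 1) hf
    (z := (z : ℂ)) z.2
  rw [extendZero_coe] at h
  refine h.congr_fun fun j => ?_
  simp [taylorCoeff]
  ring

lemma integral_exp_int_mul (m : ℤ) :
    ∫ θ in Set.Ioc (-Real.pi) Real.pi, Complex.exp (m * θ * Complex.I) =
      if m = 0 then 2 * (Real.pi : ℂ) else 0 := by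
  rw [← intervalIntegral.integral_of_le (by linarith [Real.pi_pos])]
  split_ifs with h
  · subst h
    simp
    ring
  · have hc : (m : ℂ) * Complex.I ≠ 0 := mul_ne_zero (by exact_mod_cast h) Complex.I_ne_zero
    have := integral_exp_mul_complex (a := -Real.pi) (b := Real.pi) hc
    simp_rw [mul_right_comm _ _ Complex.I, this]
    rw [div_eq_zero_iff]
    left
    rw [sub_eq_zero, Complex.exp_eq_exp_iff_exists_int]
    refine ⟨m, ?_⟩
    push_cast
    ring

/-- The Taylor series is integrated term by term, and orthogonality of the exponentials leaves only
the `j`-th term. The norms of the terms do not depend on `θ`, so absolute convergence at `z`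
justifies the interchange. -/
lemma integral_exp_mul_rotate {f : Disc → ℂ} (hf : IsAnalytic f) (z : Disc) (j : ℕ) :
    ∫ θ in Set.Ioc (-Real.pi) Real.pi, Complex.exp (-(j * θ * Complex.I)) * f (rotate θ z) =
      2 * Real.pi * (taylorCoeff f j * (z : ℂ) ^ j) := by
  have hsum : Summable fun i => ‖taylorCoeff f i * (z : ℂ) ^ i‖ :=
    (hasSum_taylorCoeff hf z).summable.norm
  have hn : ∀ (i : ℕ) (θ : ℝ),
      ‖Complex.exp (-(j * θ * Complex.I)) * (taylorCoeff f i * (rotate θ z : ℂ) ^ i)‖ =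
        ‖taylorCoeff f i * (z : ℂ) ^ i‖ := by
    intro i θ
    have : -((j : ℂ) * θ * Complex.I) = ((-(j * θ) : ℝ) : ℂ) * Complex.I := by push_cast; ring
    rw [norm_mul, this, Complex.norm_exp_ofReal_mul_I, one_mul, norm_mul, norm_mul, norm_pow,
      norm_pow, norm_rotate]
  have hcont : ∀ i : ℕ, Continuous fun θ : ℝ =>
      Complex.exp (-(j * θ * Complex.I)) * (taylorCoeff f i * (rotate θ z : ℂ) ^ i) := by
    intro i
    have := continuous_rotate_angle z
    fun_prop
  have h1 := hasSum_integral_of_summable_integral_norm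
    (μ := (volume : Measure ℝ).restrict (Set.Ioc (-Real.pi) Real.pi))
    (F := fun (i : ℕ) (θ : ℝ) =>
      Complex.exp (-(j * θ * Complex.I)) * (taylorCoeff f i * (rotate θ z : ℂ) ^ i))
    (fun i => ((hcont i).integrableOn_Icc.mono_set Set.Ioc_subset_Icc_self))
    (by simp_rw [hn]
        simp only [integral_const]
        exact hsum.const_smul _)
  have h2 : ∀ θ : ℝ, ∑' i : ℕ, Complex.exp (-(j * θ * Complex.I)) *
      (taylorCoeff f i * (rotate θ z : ℂ) ^ i) =
      Complex.exp (-(j * θ * Complex.I)) * f (rotate θ z) := fun θ =>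
    ((hasSum_taylorCoeff hf (rotate θ z)).mul_left _).tsum_eq
  simp_rw [h2] at h1
  refine h1.unique ?_
  have h3 : ∀ i : ℕ, ∫ θ in Set.Ioc (-Real.pi) Real.pi, Complex.exp (-(j * θ * Complex.I)) *
      (taylorCoeff f i * (rotate θ z : ℂ) ^ i) =
      if i = j then 2 * Real.pi * (taylorCoeff f j * (z : ℂ) ^ j) else 0 := by
    intro i
    have e : ∀ θ : ℝ, Complex.exp (-(j * θ * Complex.I)) *
        (taylorCoeff f i * (rotate θ z : ℂ) ^ i) =
        Complex.exp (((i - j : ℤ) : ℂ) * θ * Complex.I) * (taylorCoeff f i * (z : ℂ) ^ i) := by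
      intro θ
      have : (((i - j : ℤ) : ℂ) * θ * Complex.I) =
        -(j * θ * Complex.I) + i * (θ * Complex.I) := by push_cast; ring
      rw [this, Complex.exp_add, Complex.exp_nat_mul]
      simp only [rotate, mul_pow]
      ring
    simp_rw [e]
    rw [integral_mul_const, integral_exp_int_mul]
    by_cases hij : i = j
    · simp [hij]
    · have : (i : ℤ) - j ≠ 0 := by omega
      simp [hij, this]
  simp_rw [h3]
  exact hasSum_ite_eq j _

/-! ### Growth of the Dirichlet kernel in `L¹` -/

/-- The conjugate Dirichlet kernel `∑_{j < n} e^{-ijθ}`. -/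
noncomputable def dirichletKernel (n : ℕ) (θ : ℝ) : ℂ :=
  ∑ j ∈ Finset.range n, Complex.exp (-(j * θ * Complex.I))

lemma continuous_dirichletKernel (n : ℕ) : Continuous (dirichletKernel n) := by
  unfold dirichletKernel
  fun_prop

lemma norm_exp_neg_mul_I (j : ℕ) (θ : ℝ) : ‖Complex.exp (-(j * θ * Complex.I))‖ = 1 := by
  have : -((j : ℂ) * θ * Complex.I) = ((-(j * θ) : ℝ) : ℂ) * Complex.I := by push_cast; ring
  rw [this, Complex.norm_exp_ofReal_mul_I]

lemma norm_dirichletKernel_le (n : ℕ) (θ : ℝ) : ‖dirichletKernel n θ‖ ≤ n := by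
  refine (norm_sum_le _ _).trans ?_
  simp [norm_exp_neg_mul_I]

/-- The geometric sum gives `|D| |e^{-iθ} - 1| ≤ 2`, and `|e^{-iθ} - 1| = 2 |sin(θ/2)| ≥ 2|θ|/π` by
Jordan's inequality. -/
lemma norm_dirichletKernel_le_div (n : ℕ) {θ : ℝ} (h0 : θ ≠ 0) (hθ : |θ| ≤ Real.pi) :
    ‖dirichletKernel n θ‖ ≤ Real.pi / |θ| := by
  have hpos : 0 < |θ| := abs_pos.2 h0
  have e : ∀ j : ℕ, Complex.exp (-(j * θ * Complex.I)) =
      Complex.exp (Complex.I * ((-θ : ℝ) : ℂ)) ^ j := by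
    intro j
    rw [← Complex.exp_nat_mul]
    push_cast
    ring_nf
  have hg := geom_sum_mul (Complex.exp (Complex.I * ((-θ : ℝ) : ℂ))) n
  simp_rw [← e] at hg
  have h1 : ‖dirichletKernel n θ‖ * ‖Complex.exp (Complex.I * ((-θ : ℝ) : ℂ)) - 1‖ ≤ 2 := by
    rw [← norm_mul, dirichletKernel, hg]
    refine (norm_sub_le _ _).trans ?_
    rw [norm_exp_neg_mul_I]
    norm_num
  have h2 : 2 / Real.pi * |θ| ≤ ‖Complex.exp (Complex.I * ((-θ : ℝ) : ℂ)) - 1‖ := by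
    rw [Complex.norm_exp_I_mul_ofReal_sub_one, norm_mul, Real.norm_eq_abs, Real.norm_eq_abs]
    have := Real.mul_abs_le_abs_sin (x := -θ / 2) (by
      rw [abs_div, abs_neg, abs_two]; linarith)
    rw [abs_div, abs_neg, abs_two] at this
    rw [abs_two]
    linarith
  rw [le_div_iff₀ hpos]
  have h3 := mul_le_mul_of_nonneg_left h2 (norm_nonneg (dirichletKernel n θ))
  have h4 : ‖dirichletKernel n θ‖ * (2 / Real.pi * |θ|) =
    2 * (‖dirichletKernel n θ‖ * |θ|) / Real.pi := by ring
  have h5 := h3.trans h1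
  rw [h4, div_le_iff₀ Real.pi_pos] at h5
  linarith

lemma intervalIntegrable_abs_rpow {r : ℝ} (hr : -1 < r) (a : ℝ) (ha : 0 ≤ a) :
    IntervalIntegrable (fun x : ℝ => |x| ^ r) volume (-a) a := by
  have h : IntervalIntegrable (fun x : ℝ => |x| ^ r) volume 0 a := by
    refine (intervalIntegral.intervalIntegrable_rpow' hr).congr fun x hx => ?_
    rw [Set.uIoc_of_le ha] at hx
    simp only [abs_of_pos hx.1]
  refine IntervalIntegrable.trans (b := 0) ?_ h
  have h2 := h.symm
  rw [IntervalIntegrable.iff_comp_neg] at h2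
  simpa using h2

/-- The `L¹` norms of the Dirichlet kernels grow more slowly than any positive power. -/
lemma exists_lintegral_dirichletKernel_le {ε : ℝ} (hε : 0 < ε) (hε1 : ε ≤ 1) :
    ∃ C : ℝ, 0 ≤ C ∧ ∀ n : ℕ,
      ∫⁻ θ in Set.Ioc (-Real.pi) Real.pi, ‖dirichletKernel n θ‖ₑ ≤
        ENNReal.ofReal (C * (n : ℝ) ^ ε) := by
  have hint : IntegrableOn (fun θ : ℝ => Real.pi ^ (1 - ε) * |θ| ^ (ε - 1))
      (Set.Ioc (-Real.pi) Real.pi) := by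
    rw [← intervalIntegrable_iff_integrableOn_Ioc_of_le (by linarith [Real.pi_pos])]
    exact (intervalIntegrable_abs_rpow (by linarith) _ Real.pi_pos.le).const_mul _
  refine ⟨∫ θ in Set.Ioc (-Real.pi) Real.pi, Real.pi ^ (1 - ε) * |θ| ^ (ε - 1),
    integral_nonneg fun θ => by positivity, fun n => ?_⟩
  rw [← integral_mul_const, ofReal_integral_eq_lintegral_ofReal (hint.mul_const _)
    (Eventually.of_forall fun θ => by positivity)]
  refine lintegral_mono_ae ?_
  have hne : ∀ᵐ θ ∂((volume : Measure ℝ).restrict (Set.Ioc (-Real.pi) Real.pi)), θ ≠ 0 :=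
    ae_restrict_of_ae (by simp [ae_iff])
  filter_upwards [ae_restrict_mem measurableSet_Ioc, hne] with θ hθ h0
  rw [← ofReal_norm]
  refine ENNReal.ofReal_le_ofReal ?_
  have hθ' : |θ| ≤ Real.pi := abs_le.2 ⟨hθ.1.le, hθ.2⟩
  -- Interpolation between the bounds `π/|θ|` and `n`: the exponent `ε - 1 > -1` keeps the
  -- singularity at `0` integrable.
  calc ‖dirichletKernel n θ‖ = ‖dirichletKernel n θ‖ ^ (1 - ε) * ‖dirichletKernel n θ‖ ^ ε := by
        rw [← Real.rpow_add_of_nonneg (norm_nonneg _) (by linarith) hε.le, sub_add_cancel,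
          Real.rpow_one]
    _ ≤ (Real.pi / |θ|) ^ (1 - ε) * (n : ℝ) ^ ε := by
        have h1 := norm_dirichletKernel_le_div n h0 hθ'
        have h2 := norm_dirichletKernel_le n θ
        have h3 : 0 ≤ 1 - ε := by linarith
        gcongr
    _ = Real.pi ^ (1 - ε) * |θ| ^ (ε - 1) * (n : ℝ) ^ ε := by
        rw [Real.div_rpow Real.pi_pos.le (abs_nonneg _), div_eq_mul_inv,
          ← Real.rpow_neg (abs_nonneg _), neg_sub]

/-! ### Norm bounds for partial sums and coefficients -/

/-- The partial sums of the Taylor series. -/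
noncomputable def partialSum (f : Disc → ℂ) (n : ℕ) (z : Disc) : ℂ :=
  ∑ j ∈ Finset.range n, taylorCoeff f j * (z : ℂ) ^ j

lemma continuous_partialSum (f : Disc → ℂ) (n : ℕ) : Continuous (partialSum f n) := by
  unfold partialSum
  fun_prop

lemma integral_dirichletKernel_mul_rotate {f : Disc → ℂ} (hf : IsAnalytic f) (z : Disc) (n : ℕ) :
    ∫ θ in Set.Ioc (-Real.pi) Real.pi, dirichletKernel n θ * f (rotate θ z) =
      2 * Real.pi * partialSum f n z := by
  simp_rw [dirichletKernel, Finset.sum_mul, partialSum, Finset.mul_sum]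
  rw [integral_finsetSum]
  · exact Finset.sum_congr rfl fun j _ => integral_exp_mul_rotate hf z j
  · intro j _
    have := hf.continuous.comp (continuous_rotate_angle z)
    have hc : Continuous fun θ : ℝ => Complex.exp (-(j * θ * Complex.I)) * f (rotate θ z) :=
      (by fun_prop : Continuous fun θ : ℝ => Complex.exp (-(j * θ * Complex.I))).mul this
    exact hc.integrableOn_Icc.mono_set Set.Ioc_subset_Icc_self

/-- The kernels are integrated without the factor `1/(2π)`. As only the order of growth matters, the
resulting `2π ≥ 1` is dropped. -/
lemma eLpNorm_le_eLpNorm_two_pi_mul {m : Measure Disc} {p : ℝ≥0∞} (g : Disc → ℂ) :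
    eLpNorm g p m ≤ eLpNorm (fun z => 2 * (Real.pi : ℂ) * g z) p m := by
  refine eLpNorm_mono fun z => ?_
  have : (1 : ℝ) ≤ 2 * Real.pi := by linarith [Real.pi_gt_three]
  rw [norm_mul, norm_mul, Complex.norm_real, Real.norm_of_nonneg Real.pi_pos.le,
    Complex.norm_two]
  exact le_mul_of_one_le_left (norm_nonneg _) this

lemma eLpNorm_partialSum_le {p : ℝ≥0∞} (hp : 1 ≤ p) (hp' : p ≠ ∞) {μ : ℝ} (hμ : 0 ≤ μ)
    {f : Disc → ℂ} (hf : IsAnalytic f) (n : ℕ) :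
    eLpNorm (partialSum f n) p (weightMeasure μ) ≤
      (∫⁻ θ in Set.Ioc (-Real.pi) Real.pi, ‖dirichletKernel n θ‖ₑ) *
        eLpNorm f p (weightMeasure μ) := by
  refine (eLpNorm_le_eLpNorm_two_pi_mul _).trans ?_
  have h := eLpNorm_convolution_le hp hp' hμ (continuous_dirichletKernel n) hf.continuous
  simp_rw [integral_dirichletKernel_mul_rotate hf] at h
  exact h

/-- Convolution with a single exponential, whose `L¹` norm over a period is `2π`. -/
lemma eLpNorm_taylorCoeff_mul_le {p : ℝ≥0∞} (hp : 1 ≤ p) (hp' : p ≠ ∞) {μ : ℝ} (hμ : 0 ≤ μ)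
    {f : Disc → ℂ} (hf : IsAnalytic f) (j : ℕ) :
    ‖taylorCoeff f j‖ₑ * eLpNorm (fun z : Disc => (z : ℂ) ^ j) p (weightMeasure μ) ≤
      ENNReal.ofReal (2 * Real.pi) * eLpNorm f p (weightMeasure μ) := by
  have h := eLpNorm_convolution_le hp hp' hμ
    (k := fun θ : ℝ => Complex.exp (-(j * θ * Complex.I))) (by fun_prop) hf.continuous
  simp_rw [integral_exp_mul_rotate hf] at h
  have h1 : ∀ θ : ℝ, ‖Complex.exp (-(j * θ * Complex.I))‖ₑ = 1 := fun θ => by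
    rw [← ofReal_norm, norm_exp_neg_mul_I, ENNReal.ofReal_one]
  simp_rw [h1] at h
  rw [lintegral_one, Measure.restrict_apply_univ, Real.volume_Ioc] at h
  rw [← eLpNorm_const_smul]
  refine (eLpNorm_le_eLpNorm_two_pi_mul _).trans (h.trans_eq ?_)
  ring_nf

/-- Chebyshev's inequality on a disc of radius `δ/2` at distance `δ` from the unit circle, with `δ =
1/(4(j+1))`. There `|z|^j ≥ (1 - 2δ)^j ≥ 1/2` by Bernoulli, and the weighted measure is at least
`π⁻¹ δ^μ · π δ²/4`. -/
lemma le_eLpNorm_pow {p : ℝ≥0∞} (hp : 1 ≤ p) (hp' : p ≠ ∞) {μ : ℝ} (hμ : 0 ≤ μ) (j : ℕ) :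
    ENNReal.ofReal ((1 / (4 * (j + 1))) ^ (μ + 2) / 8) ≤
      eLpNorm (fun z : Disc => (z : ℂ) ^ j) p (weightMeasure μ) := by
  have hp0 : p ≠ 0 := (zero_lt_one.trans_le hp).ne'
  have hq : 1 ≤ p.toReal := by
    have := ENNReal.toReal_mono hp' hp
    simpa using this
  have hq0 : 0 < p.toReal := by linarith
  set δ : ℝ := 1 / (4 * (j + 1)) with hδ
  have hδ0 : 0 < δ := by positivity
  have hδj : δ * (4 * (j + 1)) = 1 := by rw [hδ]; field_simp
  have hj0 : (0 : ℝ) ≤ j := j.cast_nonneg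
  have hδ1 : δ ≤ 1 / 4 := by nlinarith
  set c : ℝ := 1 - 3 * δ / 2 with hc
  have hcz : ∀ z ∈ Metric.ball (c : ℂ) (δ / 2), 1 - 2 * δ ≤ ‖z‖ ∧ δ ≤ 1 - ‖z‖ := by
    intro z hz
    rw [mem_ball_iff_norm] at hz
    have h1 := (abs_le.1 (abs_norm_sub_norm_le z c))
    have h2 : ‖(c : ℂ)‖ = c := by
      rw [Complex.norm_real, Real.norm_of_nonneg (by linarith)]
    rw [h2] at h1
    constructor <;> linarith
  have he : MeasurableEmbedding (Subtype.val : Disc → ℂ) :=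
    MeasurableEmbedding.subtype_coe measurableSet_ball
  set B : Set Disc := Subtype.val ⁻¹' Metric.ball (c : ℂ) (δ / 2) with hB
  have hBm : MeasurableSet B := measurable_subtype_coe measurableSet_ball
  have hvol : (volume : Measure ℂ).comap (Subtype.val : Disc → ℂ) B =
      ENNReal.ofReal (δ ^ 2 / 4 * Real.pi) := by
    rw [he.comap_apply, hB, Subtype.image_preimage_coe, Set.inter_eq_right.2, Complex.volume_ball,
      ← ENNReal.ofReal_pow (by positivity), ENNReal.ofReal_mul (by positivity)]
    · congr 2
      · ring
      · exact (Real.toNNReal_coe (r := NNReal.pi)).symm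
    · intro z hz
      rw [mem_ball_zero_iff]
      linarith [(hcz z hz).2]
  have hmeas : ENNReal.ofReal (δ ^ (μ + 2) / 4) ≤ weightMeasure μ B := by
    rw [weightMeasure, withDensity_apply _ hBm]
    calc ENNReal.ofReal (δ ^ (μ + 2) / 4)
        = ENNReal.ofReal (Real.pi⁻¹ * δ ^ μ) * ENNReal.ofReal (δ ^ 2 / 4 * Real.pi) := by
          rw [← ENNReal.ofReal_mul (by positivity), Real.rpow_add hδ0, Real.rpow_two]
          congr 1
          field_simp
      _ = ∫⁻ _ in B, ENNReal.ofReal (Real.pi⁻¹ * δ ^ μ) ∂((volume : Measure ℂ).comap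
            (Subtype.val : Disc → ℂ)) := by rw [setLIntegral_const, hvol]
      _ ≤ _ := by
          refine setLIntegral_mono (measurable_weight μ) fun z hz => ?_
          have := (hcz z hz).2
          gcongr
  have hsub : B ⊆ {z : Disc | ENNReal.ofReal (1 / 2) ^ p.toReal ≤
      ‖(z : ℂ) ^ j‖ₑ ^ p.toReal} := by
    intro z hz
    refine ENNReal.rpow_le_rpow ?_ hq0.le
    rw [← ofReal_norm, norm_pow]
    refine ENNReal.ofReal_le_ofReal ?_
    have h1 := one_add_mul_le_pow (a := -(2 * δ)) (by linarith) j
    have h2 : (1 + -(2 * δ)) ^ j ≤ ‖(z : ℂ)‖ ^ j :=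
      pow_le_pow_left₀ (by linarith) (by linarith [(hcz z hz).1]) j
    nlinarith
  have hcheb := pow_mul_meas_ge_le_eLpNorm (weightMeasure μ) hp0 hp'
    (f := fun z : Disc => (z : ℂ) ^ j) (by fun_prop) (ENNReal.ofReal (1 / 2) ^ p.toReal)
  refine le_trans ?_ hcheb
  rw [ENNReal.mul_rpow_of_nonneg _ _ (by positivity), ← ENNReal.rpow_mul,
    mul_one_div_cancel hq0.ne', ENNReal.rpow_one]
  have hx1 : δ ^ (μ + 2) / 4 ≤ 1 := by
    have := Real.rpow_le_one hδ0.le (by linarith) (by linarith : 0 ≤ μ + 2)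
    linarith
  calc ENNReal.ofReal (δ ^ (μ + 2) / 8)
      = ENNReal.ofReal (1 / 2) * ENNReal.ofReal (δ ^ (μ + 2) / 4) := by
        rw [← ENNReal.ofReal_mul (by positivity)]
        congr 1
        ring
    -- The base and the exponent `1/p` are at most `1`, so replacing the exponent by `1` only
    -- decreases the bound and makes it independent of `p`.
    _ ≤ ENNReal.ofReal (1 / 2) * ENNReal.ofReal (δ ^ (μ + 2) / 4) ^ (1 / p.toReal) := by
        gcongr
        nth_rewrite 1 [← ENNReal.rpow_one (ENNReal.ofReal (δ ^ (μ + 2) / 4))]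
        refine ENNReal.rpow_le_rpow_of_exponent_ge (ENNReal.ofReal_le_one.2 hx1) ?_
        rw [div_le_one hq0]
        exact hq
    _ ≤ _ := by
        gcongr
        exact hmeas.trans (measure_mono hsub)

/-- Taylor coefficients of functions in a weighted Bergman space grow at most polynomially, and
are bounded by the norm. -/
lemma norm_taylorCoeff_le {p : ℝ≥0∞} (hp : 1 ≤ p) (hp' : p ≠ ∞) {μ : ℝ} (hμ : 0 ≤ μ)
    {f : Disc → ℂ} (hf : f ∈ bergman p μ) (j : ℕ) :
    ‖taylorCoeff f j‖ ≤
      16 * Real.pi * (4 * (j + 1)) ^ (μ + 2) * (eLpNorm f p (weightMeasure μ)).toReal := by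
  have h := (mul_le_mul_right (le_eLpNorm_pow hp hp' hμ j) ‖taylorCoeff f j‖ₑ).trans
    (eLpNorm_taylorCoeff_mul_le hp hp' hμ hf.1 j)
  have h2 := ENNReal.toReal_mono (ENNReal.mul_ne_top ENNReal.ofReal_ne_top hf.2.2.ne) h
  rw [ENNReal.toReal_mul, ENNReal.toReal_mul, ENNReal.toReal_ofReal (by positivity),
    ENNReal.toReal_ofReal (by positivity), toReal_enorm, one_div,
    Real.inv_rpow (by positivity)] at h2
  have hx : (0 : ℝ) < (4 * (j + 1)) ^ (μ + 2) := by positivity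
  -- Clearing the lower bound for the monomial contributes the factor `8`; with `2π` this gives
  -- `16π`.
  have h3 := mul_le_mul_of_nonneg_left h2 (by positivity : 0 ≤ 8 * (4 * ((j : ℝ) + 1)) ^ (μ + 2))
  refine le_trans (le_of_eq ?_) (h3.trans_eq (by ring))
  field_simp

/-! ### Convergence of Taylor series with a loss of weight -/

lemma summable_rpow_mul_exp_neg_sqrt {N : ℝ} (hN : 0 ≤ N) :
    Summable fun j : ℕ => (4 * ((j : ℝ) + 1)) ^ N * Real.exp (-√j) := by
  have h2 : Summable fun j : ℕ => (8 : ℝ) ^ N * (1 / (j : ℝ) ^ 2) :=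
    (Real.summable_one_div_nat_pow.2 one_lt_two).mul_left _
  refine Summable.of_norm_bounded_eventually_nat h2 ?_
  have hsq : Tendsto (fun j : ℕ => √(j : ℝ)) atTop atTop :=
    Real.tendsto_sqrt_atTop.comp tendsto_natCast_atTop_atTop
  -- The power of `√j` is chosen so that `j^N √j^(-(2N+4)) = j^(-2)`, which is summable.
  have ho := (isLittleO_exp_neg_mul_rpow_atTop one_pos (-(2 * N + 4))).comp_tendsto hsq
  filter_upwards [ho.bound one_pos, eventually_ge_atTop 1] with j hj hj1
  have hj1' : (1 : ℝ) ≤ j := by exact_mod_cast hj1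
  have hs : 0 < √(j : ℝ) := Real.sqrt_pos.2 (by linarith)
  simp only [Function.comp_apply, one_mul, neg_mul] at hj
  rw [Real.norm_of_nonneg (Real.exp_nonneg _), Real.norm_of_nonneg (by positivity)] at hj
  rw [Real.norm_of_nonneg (by positivity)]
  have e : (8 * (j : ℝ)) ^ N * √(j : ℝ) ^ (-(2 * N + 4)) = 8 ^ N * (1 / (j : ℝ) ^ 2) := by
    have h1 : (j : ℝ) ^ N = √(j : ℝ) ^ (2 * N) := by
      rw [Real.rpow_mul hs.le, Real.rpow_two, Real.sq_sqrt (by linarith)]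
    have h3 : (j : ℝ) ^ 2 = √(j : ℝ) ^ (4 : ℝ) := by
      rw [show (4 : ℝ) = 2 * 2 by norm_num, Real.rpow_mul hs.le, Real.rpow_two, Real.rpow_two,
        Real.sq_sqrt (by linarith)]
    rw [Real.mul_rpow (by norm_num) (by linarith), h1, h3, mul_assoc, ← Real.rpow_add hs,
      one_div, ← Real.rpow_neg hs.le]
    ring_nf
  calc (4 * ((j : ℝ) + 1)) ^ N * Real.exp (-√j)
      ≤ (8 * (j : ℝ)) ^ N * √(j : ℝ) ^ (-(2 * N + 4)) := by
        have h8 : 4 * ((j : ℝ) + 1) ≤ 8 * j := by linarith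
        gcongr
    _ = _ := e

/-- A bound for the remainder of the Taylor series on a compact disc of radius `1 - n ^ (-1/2)`. -/
lemma norm_sub_partialSum_le {f : Disc → ℂ} (hf : IsAnalytic f) {A N : ℝ} (hN : 0 ≤ N)
    (hA : ∀ j, ‖taylorCoeff f j‖ ≤ A * (4 * ((j : ℝ) + 1)) ^ N) {n : ℕ} (hn : 1 ≤ n) {z : Disc}
    (hz : (√(n : ℝ))⁻¹ ≤ 1 - ‖(z : ℂ)‖) :
    ‖f z - partialSum f n z‖ ≤
      ∑' j : ℕ, A * ((4 * (((j + n : ℕ) : ℝ) + 1)) ^ N * Real.exp (-√((j + n : ℕ) : ℝ))) := by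
  have h := (hasSum_nat_add_iff' n).2 (hasSum_taylorCoeff hf z)
  have hs : Summable fun j : ℕ => A * ((4 * (((j + n : ℕ) : ℝ) + 1)) ^ N *
      Real.exp (-√((j + n : ℕ) : ℝ))) :=
    (summable_nat_add_iff n).2 ((summable_rpow_mul_exp_neg_sqrt hN).mul_left A)
  rw [partialSum, ← h.tsum_eq]
  refine tsum_of_norm_bounded hs.hasSum fun j => ?_
  rw [norm_mul, norm_pow, ← mul_assoc]
  set i := j + n with hi
  have hn0 : (0 : ℝ) < n := by exact_mod_cast hn
  have hsn : 0 < √(n : ℝ) := Real.sqrt_pos.2 hn0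
  -- Here `|z| ≤ exp(-1/√n)`, and `i ≥ n` gives `i/√n ≥ √i`. The bound no longer involves `z` or
  -- `n`, so the remainder is controlled by a tail of one fixed series.
  have hzi : ‖(z : ℂ)‖ ^ i ≤ Real.exp (-√(i : ℝ)) := by
    have h1 : ‖(z : ℂ)‖ ≤ Real.exp (-(√(n : ℝ))⁻¹) := by
      have := Real.add_one_le_exp (-(√(n : ℝ))⁻¹)
      linarith
    refine (pow_le_pow_left₀ (norm_nonneg _) h1 i).trans ?_
    rw [← Real.exp_nat_mul, Real.exp_le_exp, mul_neg, neg_le_neg_iff]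
    rw [← div_eq_mul_inv, le_div_iff₀ hsn]
    calc √(i : ℝ) * √(n : ℝ) ≤ √(i : ℝ) * √(i : ℝ) := by
          gcongr
          omega
      _ = i := Real.mul_self_sqrt (Nat.cast_nonneg _)
  exact mul_le_mul (hA i) hzi (by positivity) ((norm_nonneg _).trans (hA i))

lemma weightMeasure_restrict_le {μ γ : ℝ} (h : μ ≤ γ) {δ : ℝ} (hδ : 0 ≤ δ) :
    (weightMeasure γ).restrict {z : Disc | 1 - ‖(z : ℂ)‖ ≤ δ} ≤
      ENNReal.ofReal (δ ^ (γ - μ)) • weightMeasure μ := by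
  have hs : MeasurableSet {z : Disc | 1 - ‖(z : ℂ)‖ ≤ δ} :=
    measurableSet_le (by fun_prop) measurable_const
  rw [weightMeasure, weightMeasure, restrict_withDensity hs,
    ← withDensity_smul _ (measurable_weight μ)]
  refine Measure.le_iff.2 fun t ht => ?_
  rw [withDensity_apply _ ht, withDensity_apply _ ht, Measure.restrict_restrict ht]
  refine le_trans ?_ (lintegral_mono_set
    (Set.inter_subset_left (t := {z : Disc | 1 - ‖(z : ℂ)‖ ≤ δ})))
  refine setLIntegral_mono ((measurable_weight μ).const_smul _) fun z hz => ?_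
  have hz2 : 1 - ‖(z : ℂ)‖ ≤ δ := hz.2
  have h0 := one_sub_norm_pos z
  simp only [Pi.smul_apply, smul_eq_mul]
  rw [← ENNReal.ofReal_mul (by positivity)]
  refine ENNReal.ofReal_le_ofReal ?_
  have e : (1 - ‖(z : ℂ)‖) ^ γ = (1 - ‖(z : ℂ)‖) ^ (γ - μ) * (1 - ‖(z : ℂ)‖) ^ μ := by
    rw [← Real.rpow_add h0, sub_add_cancel]
  rw [e, mul_left_comm]
  have h1 : 0 ≤ γ - μ := by linarith
  have hpi := Real.pi_pos
  gcongr

/-- On the collar `(1 - |z|)^γ ≤ δ^(γ-μ) (1 - |z|)^μ`; the `p`-th root of this factor is the gain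
that absorbs the growth of the Dirichlet kernel. -/
lemma eLpNorm_indicator_collar_le {p : ℝ≥0∞} (hp' : p ≠ ∞) {μ γ : ℝ} (h : μ ≤ γ) {δ : ℝ}
    (hδ : 0 ≤ δ) (g : Disc → ℂ) :
    eLpNorm ({z : Disc | 1 - ‖(z : ℂ)‖ ≤ δ}.indicator g) p (weightMeasure γ) ≤
      ENNReal.ofReal (δ ^ ((γ - μ) / p.toReal)) * eLpNorm g p (weightMeasure μ) := by
  have hs : MeasurableSet {z : Disc | 1 - ‖(z : ℂ)‖ ≤ δ} :=
    measurableSet_le (by fun_prop) measurable_const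
  rw [eLpNorm_indicator_eq_eLpNorm_restrict hs]
  refine (eLpNorm_mono_measure g (weightMeasure_restrict_le h hδ)).trans_eq ?_
  rw [eLpNorm_smul_measure_of_ne_top hp', smul_eq_mul, ENNReal.toReal_div, ENNReal.toReal_one,
    ENNReal.ofReal_rpow_of_nonneg (by positivity) (by positivity), ← Real.rpow_mul hδ,
    mul_one_div]

lemma tendsto_rpow_neg_mul_one_add_rpow {η ε C : ℝ} (hε : 0 < ε) (hη : ε < η) :
    Tendsto (fun n : ℕ => (n : ℝ) ^ (-η) * (1 + C * (n : ℝ) ^ ε)) atTop (𝓝 0) := by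
  have h1 := (tendsto_rpow_neg_atTop (hε.trans hη)).comp (tendsto_natCast_atTop_atTop (R := ℝ))
  have h2 := ((tendsto_rpow_neg_atTop (sub_pos.2 hη)).comp
    (tendsto_natCast_atTop_atTop (R := ℝ))).const_mul C
  have h3 := h1.add h2
  rw [mul_zero, add_zero] at h3
  refine h3.congr' ?_
  filter_upwards [eventually_ge_atTop 1] with n hn
  have hn0 : (0 : ℝ) < n := by exact_mod_cast hn
  have e : (n : ℝ) ^ (-(η - ε)) = (n : ℝ) ^ (-η) * (n : ℝ) ^ ε := by
    rw [← Real.rpow_add hn0]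
    ring_nf
  simp only [Function.comp_apply, e]
  ring

/-- The Taylor series of `f ∈ A^p_μ` converges to `f` in every `A^p_γ` with `γ > μ`. -/
theorem tendsto_eLpNorm_sub_partialSum {p : ℝ≥0∞} (hp : 1 ≤ p) (hp' : p ≠ ∞) {μ γ : ℝ}
    (hμ : 0 ≤ μ) (hμγ : μ < γ) {f : Disc → ℂ} (hf : f ∈ bergman p μ) :
    Tendsto (fun n => eLpNorm (f - partialSum f n) p (weightMeasure γ)) atTop (𝓝 0) := by
  have := isFiniteMeasure_weightMeasure (hμ.trans hμγ.le)
  have hq : 1 ≤ p.toReal := by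
    have := ENNReal.toReal_mono hp' hp
    simpa using this
  have hq0 : 0 < p.toReal := by linarith
  have hfc := hf.1.continuous
  set M := eLpNorm f p (weightMeasure μ) with hM
  have hMtop : M ≠ ∞ := hf.2.2.ne
  -- The final division by `2` reflects the collar width `n^(-1/2)`: the collar gain is exactly
  -- `n^(-η)`, and `ε < η` makes it win.
  set η := (γ - μ) / p.toReal / 2 with hη
  have hη0 : 0 < η := half_pos (div_pos (by linarith) hq0)
  set ε := min (η / 2) 1 with hε
  have hε0 : 0 < ε := lt_min (by linarith) one_pos
  have hεη : ε < η := (min_le_left _ _).trans_lt (by linarith)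
  obtain ⟨C, hC0, hC⟩ := exists_lintegral_dirichletKernel_le hε0 (min_le_right _ _)
  set A := 16 * Real.pi * M.toReal with hA
  have hcoef : ∀ j, ‖taylorCoeff f j‖ ≤ A * (4 * ((j : ℝ) + 1)) ^ (μ + 2) := fun j =>
    (norm_taylorCoeff_le hp hp' hμ hf j).trans_eq (by rw [hA]; ring)
  set T : ℕ → ℝ := fun n => ∑' j : ℕ, A * ((4 * (((j + n : ℕ) : ℝ) + 1)) ^ (μ + 2) *
    Real.exp (-√((j + n : ℕ) : ℝ))) with hT
  have hT0 : Tendsto T atTop (𝓝 0) :=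
    tendsto_sum_nat_add fun j : ℕ => A * ((4 * ((j : ℝ) + 1)) ^ (μ + 2) * Real.exp (-√(j : ℝ)))
  have hTnn : ∀ n, 0 ≤ T n := fun n => tsum_nonneg fun j => by positivity
  set S : ℕ → Set Disc := fun n => {z : Disc | 1 - ‖(z : ℂ)‖ ≤ (√(n : ℝ))⁻¹} with hS
  have hSm : ∀ n, MeasurableSet (S n) := fun n => measurableSet_le (by fun_prop) measurable_const
  have hgc : ∀ n, Continuous (f - partialSum f n) := fun n => hfc.sub (continuous_partialSum f n)
  have houter : ∀ n, 1 ≤ n → eLpNorm ((S n).indicator (f - partialSum f n)) p (weightMeasure γ) ≤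
      ENNReal.ofReal ((n : ℝ) ^ (-η) * (1 + C * (n : ℝ) ^ ε)) * M := by
    intro n hn
    refine (eLpNorm_indicator_collar_le hp' hμγ.le (by positivity) _).trans ?_
    have e : ((√(n : ℝ))⁻¹) ^ ((γ - μ) / p.toReal) = (n : ℝ) ^ (-η) := by
      rw [Real.sqrt_eq_rpow, ← Real.rpow_neg (Nat.cast_nonneg _),
        ← Real.rpow_mul (Nat.cast_nonneg _), hη]
      ring_nf
    rw [e, ENNReal.ofReal_mul (by positivity), mul_assoc]
    gcongr
    rw [ENNReal.ofReal_add zero_le_one (by positivity), ENNReal.ofReal_one, add_mul, one_mul]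
    refine (eLpNorm_sub_le hfc.aestronglyMeasurable
      (continuous_partialSum f n).aestronglyMeasurable hp).trans ?_
    gcongr
    refine (eLpNorm_partialSum_le hp hp' hμ hf.1 n).trans ?_
    gcongr
    exact hC n
  have hinner : ∀ n, 1 ≤ n → eLpNorm ((S n)ᶜ.indicator (f - partialSum f n)) p
      (weightMeasure γ) ≤ weightMeasure γ Set.univ ^ p.toReal⁻¹ * ENNReal.ofReal (T n) := by
    intro n hn
    refine eLpNorm_le_of_ae_bound (Eventually.of_forall fun z => ?_)
    by_cases hz : z ∈ (S n)ᶜ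
    · rw [Set.indicator_of_mem hz]
      refine norm_sub_partialSum_le hf.1 (by linarith) hcoef hn ?_
      exact (not_le.1 (show ¬ 1 - ‖(z : ℂ)‖ ≤ (√(n : ℝ))⁻¹ from hz)).le
    · rw [Set.indicator_of_notMem hz, norm_zero]
      exact hTnn n
  have hlim : Tendsto (fun n : ℕ => ENNReal.ofReal ((n : ℝ) ^ (-η) * (1 + C * (n : ℝ) ^ ε)) * M +
      weightMeasure γ Set.univ ^ p.toReal⁻¹ * ENNReal.ofReal (T n)) atTop (𝓝 0) := by
    have h1 := ENNReal.Tendsto.mul_const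
      (ENNReal.tendsto_ofReal (tendsto_rpow_neg_mul_one_add_rpow (C := C) hε0 hεη))
      (Or.inr hMtop)
    have h2 := ENNReal.Tendsto.const_mul (ENNReal.tendsto_ofReal hT0)
      (Or.inr (ENNReal.rpow_ne_top_of_nonneg (by positivity : 0 ≤ p.toReal⁻¹)
        (measure_ne_top (weightMeasure γ) Set.univ)))
    simpa using h1.add h2
  refine tendsto_of_tendsto_of_tendsto_of_le_of_le' tendsto_const_nhds hlim
    (Eventually.of_forall fun _ => zero_le) ?_
  filter_upwards [eventually_ge_atTop 1] with n hn
  conv_lhs => rw [← Set.indicator_self_add_compl (S n) (f - partialSum f n)]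
  refine (eLpNorm_add_le ((hgc n).aestronglyMeasurable.indicator (hSm n))
    ((hgc n).aestronglyMeasurable.indicator (hSm n).compl) hp).trans ?_
  exact add_le_add (houter n hn) (hinner n hn)

/-! ### Taylor coefficients as linear forms and biorthogonality -/

lemma extendZero_add (f g : Disc → ℂ) : extendZero (f + g) = extendZero f + extendZero g := by
  funext z
  by_cases hz : ∃ w : Disc, (w : ℂ) = z
  · obtain ⟨w, rfl⟩ := hz
    simp [extendZero_coe]
  · simp [extendZero, Function.extend_apply' _ _ _ hz]

lemma extendZero_smul (c : ℂ) (f : Disc → ℂ) : extendZero (c • f) = c • extendZero f := by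
  funext z
  by_cases hz : ∃ w : Disc, (w : ℂ) = z
  · obtain ⟨w, rfl⟩ := hz
    simp [extendZero_coe]
  · simp [extendZero, Function.extend_apply' _ _ _ hz]

lemma IsAnalytic.contDiffAt {f : Disc → ℂ} (hf : IsAnalytic f) (j : ℕ) :
    ContDiffAt ℂ j (extendZero f) 0 :=
  (hf.analyticAt (Metric.ball_mem_nhds 0 one_pos)).contDiffAt

lemma taylorCoeff_add {f g : Disc → ℂ} (hf : IsAnalytic f) (hg : IsAnalytic g) (j : ℕ) :
    taylorCoeff (f + g) j = taylorCoeff f j + taylorCoeff g j := by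
  rw [taylorCoeff, extendZero_add, iteratedDeriv_add (hf.contDiffAt j) (hg.contDiffAt j), add_div]
  rfl

lemma taylorCoeff_smul (c : ℂ) (f : Disc → ℂ) (j : ℕ) :
    taylorCoeff (c • f) j = c * taylorCoeff f j := by
  rw [taylorCoeff, extendZero_smul, iteratedDeriv_const_smul_field, smul_eq_mul, mul_div_assoc]
  rfl

lemma taylorCoeff_pow (k j : ℕ) :
    taylorCoeff (fun z : Disc => (z : ℂ) ^ k) j = if j = k then 1 else 0 := by
  have h : extendZero (fun z : Disc => (z : ℂ) ^ k) =ᶠ[𝓝 0] fun z => z ^ k := by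
    filter_upwards [Metric.ball_mem_nhds (0 : ℂ) one_pos] with z hz
    exact extendZero_coe _ ⟨z, hz⟩
  rw [taylorCoeff, h.iteratedDeriv_eq, iteratedDeriv_fun_pow_zero]
  split_ifs with hjk <;> simp_all [Nat.factorial_ne_zero]

/-- The space of analytic functions on the disc. -/
def analyticFunctions : Submodule ℂ (Disc → ℂ) where
  carrier := {f | IsAnalytic f}
  zero_mem' := isAnalytic_of_eq (F := 0) (differentiableOn_const 0) fun _ => rfl
  add_mem' {f g} hf hg := isAnalytic_of_eq (hf.add hg) fun z => by simp [extendZero_coe]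
  smul_mem' c f hf := isAnalytic_of_eq (hf.const_smul c) fun z => by simp [extendZero_coe]

/-- The Taylor coefficients as linear forms on the analytic functions. -/
noncomputable def taylorCoeffLinear (j : ℕ) : analyticFunctions →ₗ[ℂ] ℂ where
  toFun f := taylorCoeff f j
  map_add' f g := taylorCoeff_add f.2 g.2 j
  map_smul' c f := taylorCoeff_smul c f j

/-- A topological vector space with continuous linear forms that are biorthogonal to a sequence
`x` and give expansions has `x` as a Schauder basis. -/
lemma isSchauderBasis_of_biorthogonal {𝕜 E : Type*} [NormedField 𝕜] [AddCommGroup E] [Module 𝕜 E]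
    [TopologicalSpace E] {x : ℕ → E} (f : ℕ → (E →L[𝕜] 𝕜))
    (hx : ∀ j k, f j (x k) = if j = k then 1 else 0)
    (h : ∀ y, Tendsto (fun n => ∑ j ∈ Finset.range n, f j y • x j) atTop (𝓝 y)) :
    IsSchauderBasis 𝕜 x := by
  refine ⟨f, fun y => ⟨h y, fun c hc j => ?_⟩⟩
  -- Applying `f j` to the partial sums of another expansion gives `c j` as soon as `n > j`.
  have h1 := ((f j).continuous.tendsto y).comp hc
  refine tendsto_nhds_unique (tendsto_const_nhds.congr' ?_) h1
  filter_upwards [eventually_gt_atTop j] with n hn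
  simp [map_sum, hx, Finset.mem_range.2 hn]

/-! ### Passage to `A^p_{α+}` and `A^p_{α-}` -/

section

variable (p : ℝ≥0∞)

/-- The monomial `z ^ j` as an element of `A^p_μ`. -/
noncomputable def monomialBergman {μ : ℝ} (hμ : 0 ≤ μ) (j : ℕ) : Bergman p μ :=
  ⟨fun z => (z : ℂ) ^ j, pow_mem_bergman p hμ j⟩

/-- The Taylor coefficients as linear forms on `A^p_μ`. -/
noncomputable def taylorCoeffBergman (μ : ℝ) (j : ℕ) : Bergman p μ →ₗ[ℂ] ℂ :=
  (taylorCoeffLinear j).comp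
    (Submodule.inclusion (fun _ hf => hf.1 : bergman p μ ≤ analyticFunctions))

variable {p}

lemma coe_sum_monomialBergman {μ : ℝ} (hμ : 0 ≤ μ) (f : Disc → ℂ) (n : ℕ) :
    (∑ j ∈ Finset.range n, taylorCoeff f j • monomialBergman p hμ j : Bergman p μ).1 =
      partialSum f n := by
  refine (map_sum (bergman p μ).subtype (fun j => taylorCoeff f j • monomialBergman p hμ j)
    _).trans ?_
  funext z
  rw [Finset.sum_apply]
  rfl

variable [Fact (1 ≤ p)]

lemma norm_bergman_eq {μ : ℝ} (f : Bergman p μ) :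
    ‖f‖ = (eLpNorm f.1 p (weightMeasure μ)).toReal := rfl

lemma continuous_taylorCoeffBergman (hp : p ≠ ∞) {μ : ℝ} (hμ : 0 ≤ μ) (j : ℕ) :
    Continuous (taylorCoeffBergman p μ j) :=
  AddMonoidHomClass.continuous_of_bound _ (16 * Real.pi * (4 * ((j : ℝ) + 1)) ^ (μ + 2))
    fun f => norm_taylorCoeff_le Fact.out hp hμ f.2 j

lemma tendsto_sum_monomialBergman (hp : p ≠ ∞) {μ γ : ℝ} (hμ : 0 ≤ μ) (hμγ : μ < γ)
    (f : Bergman p γ) (hf : f.1 ∈ bergman p μ) :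
    Tendsto (fun n => ∑ j ∈ Finset.range n,
      taylorCoeff f.1 j • monomialBergman p (hμ.trans hμγ.le) j) atTop (𝓝 f) := by
  rw [tendsto_iff_norm_sub_tendsto_zero]
  have h := (ENNReal.tendsto_toReal ENNReal.zero_ne_top).comp
    (tendsto_eLpNorm_sub_partialSum (Fact.out : 1 ≤ p) hp hμ hμγ hf)
  rw [ENNReal.toReal_zero] at h
  refine h.congr fun n => ?_
  rw [norm_sub_rev, norm_bergman_eq, Function.comp_apply, ← coe_sum_monomialBergman]
  rfl

variable {α : ℝ}

lemma tendsto_sum_monomialPlus (hα : 0 < α) (hp : p ≠ ∞) (f : BergmanPlus p α) :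
    Tendsto (fun n => ∑ j ∈ Finset.range n, taylorCoeff f.1 j • monomialPlus p hα j)
      atTop (𝓝 f) := by
  rw [(withSeminorms_plusNorms p α).tendsto_nhds]
  intro i ε hε
  have hi : (0 : ℝ) < 1 / (i + 1) := Nat.one_div_pos_of_nat
  -- The smaller weight is the midpoint of `α` and `α + 1/(i+1)`; `f` belongs to that space because
  -- it lies in all `A^p_μ` with `μ > α`.
  have h := tendsto_sum_monomialBergman hp (μ := α + 1 / ((i : ℝ) + 1) / 2)
    (γ := α + 1 / ((i : ℝ) + 1)) (by linarith) (by linarith)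
    (fromPlus p (lt_add_of_pos_right α hi) f) (mem_bergmanPlus_iff.1 f.2 _ (by linarith))
  rw [tendsto_iff_norm_sub_tendsto_zero] at h
  filter_upwards [h.eventually_lt_const hε] with n hn
  refine lt_of_eq_of_lt ?_ hn
  change ‖fromPlus p (lt_add_of_pos_right α hi) _‖ = _
  rw [map_sub, map_sum]
  rfl

lemma tendsto_sum_monomialMinus (hα : 0 < α) (hp : p ≠ ∞) (f : BergmanMinus p α) :
    Tendsto (fun n => ∑ j ∈ Finset.range n, taylorCoeff f.1 j • monomialMinus p hα j)
      atTop (𝓝 f) := by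
  obtain ⟨μ, hμ0, hμα, hf⟩ := (mem_bergmanMinus_iff hα).1 f.2
  -- Convergence in the single step `A^p_γ` suffices, since its inclusion is continuous.
  obtain ⟨γ, hμγ, hγα⟩ := exists_between hμα
  have hγ : γ ∈ Set.Ioo 0 α := ⟨hμ0.trans hμγ, hγα⟩
  have h := ((continuous_toMinus p α hγ).tendsto _).comp
    (tendsto_sum_monomialBergman hp hμ0.le hμγ ⟨f.1, bergman_mono p hμγ.le hf⟩ hf)
  refine h.congr fun n => ?_
  rw [Function.comp_apply, map_sum]
  rfl

variable (p α)

/-- The Taylor coefficients as continuous linear forms on `A^p_{α+}`. -/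
noncomputable def taylorCoeffPlus (hp : p ≠ ∞) (hα : 0 < α) (j : ℕ) :
    BergmanPlus p α →L[ℂ] ℂ where
  -- One defining norm is enough for continuity; index `0` stands for the weight `α + 1`.
  toLinearMap := (taylorCoeffBergman p (α + 1 / (((0 : ℕ) : ℝ) + 1)) j).comp
    (fromPlus p (lt_add_of_pos_right α Nat.one_div_pos_of_nat))
  cont := by
    refine (continuous_taylorCoeffBergman hp
      (add_pos hα Nat.one_div_pos_of_nat).le j).comp ?_
    refine continuous_of_continuousAt_zero
      (fromPlus p (lt_add_of_pos_right α Nat.one_div_pos_of_nat)) ?_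
    rw [ContinuousAt, map_zero, tendsto_zero_iff_norm_tendsto_zero]
    have h := ((withSeminorms_plusNorms p α).continuous_seminorm 0).tendsto 0
    rw [map_zero] at h
    exact h

/-- Universal property of the inductive limit: the topology induced by `L` is itself a locally
convex vector topology making all inclusions continuous, hence is coarser than the finest one. -/
lemma continuous_bergmanMinus_dom (L : BergmanMinus p α →ₗ[ℂ] ℂ)
    (hL : ∀ (μ : ℝ) (hμ : μ ∈ Set.Ioo 0 α), Continuous (L ∘ toMinus p hμ)) : Continuous L := by
  refine continuous_sInf_dom (t := TopologicalSpace.induced L inferInstance) ⟨?_, ?_, ?_, ?_⟩ continuous_induced_dom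
  · exact topologicalAddGroup_induced L
  · exact continuousSMul_induced L
  · exact LocallyConvexSpace.induced (L.restrictScalars ℝ)
  · exact fun μ hμ => continuous_induced_rng.2 (hL μ hμ)

/-- The Taylor coefficients as continuous linear forms on `A^p_{α-}`. -/
noncomputable def taylorCoeffMinus (hp : p ≠ ∞) (j : ℕ) : BergmanMinus p α →L[ℂ] ℂ where
  toLinearMap := (taylorCoeffLinear j).comp (Submodule.inclusion
    (iSup_le fun _ _ hf => hf.1 : bergmanMinus p α ≤ analyticFunctions))
  cont := continuous_bergmanMinus_dom p α _ fun _ hμ =>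
    continuous_taylorCoeffBergman hp hμ.1.le j

end

end WeightedBergman

theorem theorem3p4 (p : ℝ≥0∞) [Fact (1 ≤ p)] (hp₁ : 1 < p) (hp₂ : p < ∞) (α : ℝ) (hα : 0 < α) :
    (WeightedBergman.IsSchauderBasis ℂ (WeightedBergman.monomialPlus p hα) ∧
      ∀ f : WeightedBergman.BergmanPlus p α,
        Tendsto (fun n => ∑ j ∈ Finset.range n,
          WeightedBergman.taylorCoeff f.1 j • WeightedBergman.monomialPlus p hα j)
          atTop (𝓝 f)) ∧
    (WeightedBergman.IsSchauderBasis ℂ (WeightedBergman.monomialMinus p hα) ∧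
      ∀ f : WeightedBergman.BergmanMinus p α,
        Tendsto (fun n => ∑ j ∈ Finset.range n,
          WeightedBergman.taylorCoeff f.1 j • WeightedBergman.monomialMinus p hα j)
          atTop (𝓝 f)) := by
  refine ⟨⟨?_, WeightedBergman.tendsto_sum_monomialPlus hα hp₂.ne⟩,
    ⟨?_, WeightedBergman.tendsto_sum_monomialMinus hα hp₂.ne⟩⟩
  · exact WeightedBergman.isSchauderBasis_of_biorthogonal
      (WeightedBergman.taylorCoeffPlus p α hp₂.ne hα)
      (fun j k => WeightedBergman.taylorCoeff_pow k j)
      (WeightedBergman.tendsto_sum_monomialPlus hα hp₂.ne)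
  · exact WeightedBergman.isSchauderBasis_of_biorthogonal
      (WeightedBergman.taylorCoeffMinus p α hp₂.ne)
      (fun j k => WeightedBergman.taylorCoeff_pow k j)
      (WeightedBergman.tendsto_sum_monomialMinus hα hp₂.ne)
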